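/- Let $\Gamma=\mathbb Z_2^n$, written additively, with $\mathsf b(a,b)=\sum_j a_jb_j\in\mathbb Z_2$, $\beta(a,b)=(-1)^{\mathsf b(a,b)}$, $\mathbf u(a)=|\{j: a_j=1\}|$ and $\alpha(a)=e^{\frac{\pi i}{2}\mathbf u(a)}$ for $a,b\in\Gamma$. A $\Gamma$-Lie superalgebra is a real vector space $\mathfrak g=\bigoplus_{a\in\Gamma}\mathfrak g_a$ with a bilinear bracket such that $[\mathfrak g_a,\mathfrak g_b]\subseteq\mathfrak g_{a+b}$, $[x,y]=-\beta(a,b)[y,x]$ and $[x,[y,z]]=[[x,y],z]-\beta(a,b)\beta(a,c)[y,[z,x]]$ for $x\in\mathfrak g_a$, $y\in\mathfrak g_b$, $z\in\mathfrak g_c$. A $\Gamma$-Harish-Chandra pair $(G_0,\mathfrak g)$ consists of a (finite-dimensional real) Lie group $G_0$ and a $\Gamma$-Lie superalgebra $\mathfrak g$ with an identification $\mathfrak g_0\cong\mathrm{Lie}(G_0)$ of Lie algebras and an action $\mathrm{Ad}$ of $G_0$ on $\mathfrak g$ by linear operators that preserve the grading and the bracket, extending the adjoint action of $G_0$ on $\mathfrak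 g_0$. Let $\mathfrak U(\mathfrak g_{\mathbb C})$ be the quotient of the tensor algebra of $\mathfrak g_{\mathbb C}=\mathfrak g\otimes_{\mathbb R}\mathbb C$ by the two-sided ideal generated by $x\otimes y-\beta(|x|,|y|)\,y\otimes x-[x,y]$ for homogeneous $x,y$, with the induced $\Gamma$-grading. Let $D\mapsto D^*$ be the conjugate-linear anti-automorphism of $\mathfrak U(\mathfrak g_{\mathbb C})$ with $x^*=-\overline{\alpha(a)}x$ for $x\in\mathfrak g_a$. Let $\mathcal S=G_0\ltimes\mathfrak U(\mathfrak g_{\mathbb C})$ be the monoid with product $(g_1,D_1)(g_2,D_2)=(g_1g_2,(\mathrm{Ad}(g_2^{-1})D_1)D_2)$ and involution $(g,D)^*=(g^{-1},\mathrm{Ad}(g)(D^*))$, and put $\mathcal S_a=\{(g,D): D \text{ homogeneous of degree } a\}$ for $a\in\Gamma$. Let $C^\infty(\mathcal G)=\mathrm{Hom}_{\mathfrak g_0}(\mathfrak U(\mathfrak g_{\mathbb C}),C^\infty(G_0;\mathbb C))$, the space of complex linear maps $f$ with $f(xD)=\mathrm L_xf(D)$ for $x\in\mathfrak g_0$, where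 $\mathrm L_x$ is the left invariant differential operator of $x$; for $f\in C^\infty(\mathcal G)$ let $\check f:\mathcal S\to\mathbb C$ be given by $\check f(g,D)=f(D)(g)$. Call $f$ positive definite if (i) $\check f$ vanishes on $\mathcal S_a$ for every $a\ne0$, and (ii) $\sum_{i,j}\overline{c_i}c_j\check f(s_i^*s_j)\ge0$ for all finite families $c_i\in\mathbb C$, $s_i\in\mathcal S$. A $\Gamma$-graded Hilbert space is a $\Gamma$-graded complex vector space $\mathscr H$ with a sesquilinear form $\langle\cdot,\cdot\rangle$, linear in the first variable, for which different components are orthogonal, $\langle w,v\rangle=\beta(a,a)\overline{\langle v,w\rangle}$ and $\alpha(a)\langle v,v\rangle\ge0$ for $v,w\in\mathscr H_a$, and which is a Hilbert space for the ordinary inner product given by $(v,w)=\alpha(a)\langle v,w\rangle$ for $v,w\in\mathscr H_a$ and $(v,w)=0$ for $v,w$ of different degrees. A smooth unitary representation $(\pi,\rho^\pi,\mathscr H)$ of $(G_0,\mathfrak g)$ consists of a $\Gamma$-graded Hilbert space $\mathscr H$, a strongly continuous unitary representation $\pi$ of $G_0$ on $\mathscr H$ that preserves the grading and has a dense space $\mathscr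 H^\infty$ of smooth vectors, and a real linear map $\rho^\pi:\mathfrak g\to\mathrm{End}_{\mathbb C}(\mathscr H^\infty)$ with $\rho^\pi(\mathfrak g_a)(\mathscr H^\infty\cap\mathscr H_b)\subseteq\mathscr H_{a+b}$ and $\rho^\pi([x,y])=\rho^\pi(x)\rho^\pi(y)-\beta(a,b)\rho^\pi(y)\rho^\pi(x)$ for $x\in\mathfrak g_a$, $y\in\mathfrak g_b$, such that: $\rho^\pi(x)v=\lim_{t\to0}\frac1t(\pi(\exp(tx))v-v)$ for $x\in\mathfrak g_0$, $v\in\mathscr H^\infty$; $\langle v,\rho^\pi(x)w\rangle=-\beta(a,b)\langle\rho^\pi(x)v,w\rangle$ for $x\in\mathfrak g_a$, $v\in\mathscr H^\infty\cap\mathscr H_b$, $w\in\mathscr H^\infty$ (that is, $\rho^\pi(x)^\dagger=-\rho^\pi(x)$); and $\pi(g)\rho^\pi(x)\pi(g)^{-1}=\rho^\pi(\mathrm{Ad}(g)x)$ for $g\in G_0$, $x\in\mathfrak g$. Extend $\rho^\pi$ to $\mathfrak U(\mathfrak g_{\mathbb C})$. **Proposition.** Let $(\pi,\rho^\pi,\mathscr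 H)$ be a smooth unitary representation of a $\Gamma$-Harish-Chandra pair $(G_0,\mathfrak g)$, and let $v,w\in\mathscr H^\infty$ be homogeneous vectors of the same degree. Let $\varphi_{v,w}:\mathcal S\to\mathbb C$, $\varphi_{v,w}(g,D)=(\pi(g)\rho^\pi(D)v,w)$. Then there is an $f\in C^\infty(\mathcal G)$ with $\check f=\varphi_{v,w}$. Moreover $\check f$ vanishes on $\mathcal S_a$ for every $a\neq0$, and if $v=w$ then $f$ is positive definite. -/

import Mathlib

open scoped ContDiff Manifold TensorProduct ComplexOrder

noncomputable section

namespace GammaSuper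

/-! ### The grading group and the commutation factor -/

/-- The grading group `Γ = ℤ₂ⁿ`, written additively. -/
abbrev Gam (n : ℕ) : Type := Fin n → ZMod 2

/-- The standard symmetric form `b(a, b) = ∑ a_j b_j` on `Γ`. -/
def bform {n : ℕ} (a b : Gam n) : ZMod 2 := ∑ j, a j * b j

/-- The commutation factor `β(a, b) = (-1) ^ b(a, b)`, as an integer. -/
def beta {n : ℕ} (a b : Gam n) : ℤ := (-1) ^ (bform a b).val

/-- `u(a)` is the number of indices `j` with `a_j = 1`. -/
def uCount {n : ℕ} (a : Gam n) : ℕ := (Finset.univ.filter fun j => a j = 1).card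

/-- `α(a) = exp((π i / 2) u(a))`. -/
def alpha {n : ℕ} (a : Gam n) : ℂ :=
  Complex.exp ((Real.pi : ℂ) * Complex.I / 2 * (uCount a : ℂ))

theorem negOnePow_val_add (x y : ZMod 2) :
    ((-1 : ℤ)) ^ (x + y).val = (-1) ^ x.val * (-1) ^ y.val := by
  revert x y; decide

theorem beta_eq_prod {n : ℕ} (a b : Gam n) :
    beta a b = ∏ j, (-1 : ℤ) ^ (a j * b j).val := by
  have key : ∀ s : Finset (Fin n), (-1 : ℤ) ^ (∑ j ∈ s, a j * b j).val
      = ∏ j ∈ s, (-1 : ℤ) ^ (a j * b j).val := by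
    intro s
    induction s using Finset.induction_on with
    | empty => simp
    | insert i s hi ih =>
      rw [Finset.sum_insert hi, Finset.prod_insert hi, negOnePow_val_add, ih]
  exact key Finset.univ

theorem alpha_eq_prod {n : ℕ} (a : Gam n) : alpha a = ∏ j, Complex.I ^ (a j).val := by
  have h1 : alpha a = Complex.I ^ uCount a := by
    unfold alpha
    rw [mul_comm, Complex.exp_nat_mul]
    congr 1
    rw [mul_div_right_comm]
    exact Complex.exp_pi_div_two_mul_I
  have h2 : uCount a = ∑ j, (a j).val := by
    unfold uCount
    rw [Finset.card_filter]
    refine Finset.sum_congr rfl fun j _ => ?_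
    generalize a j = z
    revert z; decide
  rw [h1, h2, Finset.prod_pow_eq_pow_sum]

theorem alpha_add {n : ℕ} (a b : Gam n) :
    alpha (a + b) = (beta a b : ℂ) * (alpha a * alpha b) := by
  rw [alpha_eq_prod, alpha_eq_prod, alpha_eq_prod, beta_eq_prod]
  push_cast
  rw [← Finset.prod_mul_distrib, ← Finset.prod_mul_distrib]
  refine Finset.prod_congr rfl fun j _ => ?_
  have hz : ∀ z : ZMod 2, z = 0 ∨ z = 1 := by decide
  have h1 : ((1 : ZMod 2) + 1) = 0 := by decide
  have h2 : (1 : ZMod 2).val = 1 := by decide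
  rcases hz (a j) with h | h <;> rcases hz (b j) with h' | h' <;>
    simp [Pi.add_apply, h, h', h1, h2]

theorem beta_mul_self {n : ℕ} (a b : Gam n) : beta a b * beta a b = 1 := by
  unfold beta
  rw [← pow_add, ← two_mul, pow_mul]
  simp

/-! ### `Γ`-Lie superalgebras and their enveloping algebras -/

/-- A `Γ`-Lie superalgebra (Lie colour algebra) structure on a real vector space `𝔤`. -/
structure LieSuperalgebra (n : ℕ) (𝔤 : Type*) [AddCommGroup 𝔤] [Module ℝ 𝔤] where
  /-- the homogeneous component `𝔤_a` -/
  gr : Gam n → Submodule ℝ 𝔤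
  isInternal : DirectSum.IsInternal gr
  bracket : 𝔤 →ₗ[ℝ] 𝔤 →ₗ[ℝ] 𝔤
  bracket_mem : ∀ (a b : Gam n) (x y : 𝔤), x ∈ gr a → y ∈ gr b → bracket x y ∈ gr (a + b)
  bracket_skew : ∀ (a b : Gam n) (x y : 𝔤), x ∈ gr a → y ∈ gr b →
    bracket x y = -(beta a b • bracket y x)
  /-- the graded Jacobi identity; by `bracket_skew` the last term
  equals `β(a, b) [y, [x, z]]` -/
  jacobi : ∀ (a b c : Gam n) (x y z : 𝔤), x ∈ gr a → y ∈ gr b → z ∈ gr c →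
    bracket x (bracket y z)
      = bracket (bracket x y) z - (beta a b * beta a c) • bracket y (bracket z x)

namespace LieSuperalgebra

variable {n : ℕ} {𝔤 : Type*} [AddCommGroup 𝔤] [Module ℝ 𝔤] (L : LieSuperalgebra n 𝔤)

/-- The component of degree `a` of the complexification `𝔤_ℂ = ℂ ⊗ 𝔤`. -/
def grC (a : Gam n) : Submodule ℂ (ℂ ⊗[ℝ] 𝔤) := (L.gr a).baseChange ℂ

/-- The complex bilinear extension of the bracket to `𝔤_ℂ`. -/
def bracketC : (ℂ ⊗[ℝ] 𝔤) →ₗ[ℂ] (ℂ ⊗[ℝ] 𝔤) →ₗ[ℂ] (ℂ ⊗[ℝ] 𝔤) :=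
  LinearMap.BilinMap.baseChange ℂ L.bracket

/-- The relations `x ⊗ y - β(|x|, |y|) y ⊗ x = [x, y]`, for homogeneous `x, y ∈ 𝔤_ℂ`. -/
inductive UEARel : TensorAlgebra ℂ (ℂ ⊗[ℝ] 𝔤) → TensorAlgebra ℂ (ℂ ⊗[ℝ] 𝔤) → Prop
  | of (a b : Gam n) (x y : ℂ ⊗[ℝ] 𝔤) (hx : x ∈ L.grC a) (hy : y ∈ L.grC b) :
      UEARel
        (TensorAlgebra.ι ℂ x * TensorAlgebra.ι ℂ y
          - beta a b • (TensorAlgebra.ι ℂ y * TensorAlgebra.ι ℂ x))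
        (TensorAlgebra.ι ℂ (L.bracketC x y))

/-- The universal enveloping algebra `𝔘(𝔤_ℂ)`: the tensor algebra of `𝔤_ℂ` modulo the two-sided
ideal generated by the relations above. -/
def UEA : Type _ := RingQuot L.UEARel

instance : Ring L.UEA := inferInstanceAs (Ring (RingQuot L.UEARel))

instance : Algebra ℂ L.UEA := inferInstanceAs (Algebra ℂ (RingQuot L.UEARel))

/-- The canonical map `𝔤_ℂ → 𝔘(𝔤_ℂ)`. -/
def ι : (ℂ ⊗[ℝ] 𝔤) →ₗ[ℂ] L.UEA :=
  (RingQuot.mkAlgHom ℂ L.UEARel).toLinearMap ∘ₗ TensorAlgebra.ι ℂ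

/-- `IsMonomial a D`: `D` is a product `x₁ ⋯ x_k` (possibly empty) of homogeneous elements of
`𝔤_ℂ` whose degrees add up to `a`. -/
inductive IsMonomial : Gam n → L.UEA → Prop
  | one : IsMonomial 0 1
  | mul (a b : Gam n) (x : ℂ ⊗[ℝ] 𝔤) (D : L.UEA) (hx : x ∈ L.grC a) (hD : IsMonomial b D) :
      IsMonomial (a + b) (L.ι x * D)

/-- The homogeneous component of degree `a` of `𝔘(𝔤_ℂ)`. -/
def grU (a : Gam n) : Submodule ℂ L.UEA := Submodule.span ℂ {D | L.IsMonomial a D}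

theorem ι_rel (a b : Gam n) (x y : 𝔤) (hx : x ∈ L.gr a) (hy : y ∈ L.gr b) :
    L.ι (1 ⊗ₜ x) * L.ι (1 ⊗ₜ y) - beta a b • (L.ι (1 ⊗ₜ y) * L.ι (1 ⊗ₜ x))
      = L.ι (1 ⊗ₜ L.bracket x y) := by
  have h := RingQuot.mkAlgHom_rel ℂ (UEARel.of (L := L) a b (1 ⊗ₜ x) (1 ⊗ₜ y)
    (Submodule.tmul_mem_baseChange_of_mem 1 hx) (Submodule.tmul_mem_baseChange_of_mem 1 hy))
  rw [map_sub, map_zsmul, map_mul, map_mul] at h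
  have e : L.bracketC (1 ⊗ₜ x) (1 ⊗ₜ y) = 1 ⊗ₜ L.bracket x y := by simp [bracketC]
  rw [e] at h
  exact h

/-- The universal property of `𝔘(𝔤_ℂ)`: existence of the extension. -/
def lift {B : Type*} [Ring B] [Algebra ℂ B] (f : (ℂ ⊗[ℝ] 𝔤) →ₗ[ℂ] B)
    (hf : ∀ (a b : Gam n) (x y : 𝔤), x ∈ L.gr a → y ∈ L.gr b →
      f (1 ⊗ₜ x) * f (1 ⊗ₜ y) - beta a b • (f (1 ⊗ₜ y) * f (1 ⊗ₜ x))
        = f (1 ⊗ₜ L.bracket x y)) : L.UEA →ₐ[ℂ] B :=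
  RingQuot.liftAlgHom ℂ ⟨TensorAlgebra.lift ℂ f, by
    rintro _ _ ⟨a, b, x, y, hx, hy⟩
    simp only [map_sub, map_zsmul, map_mul, TensorAlgebra.lift_ι_apply]
    rw [grC, Submodule.baseChange_eq_span] at hx hy
    induction hx using Submodule.span_induction with
    | mem x hx =>
      obtain ⟨x, hx, rfl⟩ := hx
      induction hy using Submodule.span_induction with
      | mem y hy =>
        obtain ⟨y, hy, rfl⟩ := hy
        simpa [bracketC] using hf a b x y hx hy
      | zero => simp
      | add y y' _ _ h h' =>
        simp only [map_add, mul_add, add_mul, smul_add, ← h, ← h']; abel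
      | smul c y _ h =>
        simp only [map_smul, mul_smul_comm, smul_mul_assoc, ← h, smul_sub]
        rw [smul_comm c (beta a b)]
    | zero => simp
    | add x x' _ _ h h' =>
      simp only [map_add, LinearMap.add_apply, mul_add, add_mul, smul_add, ← h, ← h']; abel
    | smul c x _ h =>
      simp only [map_smul, LinearMap.smul_apply, mul_smul_comm, smul_mul_assoc, ← h, smul_sub]
      rw [smul_comm c (beta a b)]⟩

theorem lift_ι {B : Type*} [Ring B] [Algebra ℂ B] (f : (ℂ ⊗[ℝ] 𝔤) →ₗ[ℂ] B)
    (hf : ∀ (a b : Gam n) (x y : 𝔤), x ∈ L.gr a → y ∈ L.gr b →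
      f (1 ⊗ₜ x) * f (1 ⊗ₜ y) - beta a b • (f (1 ⊗ₜ y) * f (1 ⊗ₜ x))
        = f (1 ⊗ₜ L.bracket x y)) (x : ℂ ⊗[ℝ] 𝔤) : L.lift f hf (L.ι x) = f x := by
  refine (RingQuot.liftAlgHom_mkAlgHom_apply _ _ _ _).trans ?_
  simp

theorem algHom_ext {B : Type*} [Ring B] [Algebra ℂ B] (f g : L.UEA →ₐ[ℂ] B)
    (h : ∀ x : 𝔤, f (L.ι (1 ⊗ₜ x)) = g (L.ι (1 ⊗ₜ x))) : f = g := by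
  apply RingQuot.ringQuot_ext'
  apply TensorAlgebra.hom_ext
  apply LinearMap.restrictScalars_injective ℝ
  apply TensorProduct.ext'
  intro z x
  have hz : (z ⊗ₜ[ℝ] x : ℂ ⊗[ℝ] 𝔤) = z • ((1 : ℂ) ⊗ₜ[ℝ] x) := by
    rw [TensorProduct.smul_tmul', smul_eq_mul, mul_one]
  simp only [LinearMap.restrictScalars_apply, hz, map_smul]
  exact congrArg (z • ·) (h x)

/-! ### The conjugate-linear anti-automorphism `D ↦ D*` -/

/-- The real-linear map `x ↦ x* = -conj(α(a)) x` (for `x ∈ 𝔤_a`) from `𝔤` to `𝔤_ℂ`. -/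
def starReal : 𝔤 →ₗ[ℝ] ℂ ⊗[ℝ] 𝔤 :=
  DirectSum.toModule ℝ (Gam n) (ℂ ⊗[ℝ] 𝔤)
      (fun a => (TensorProduct.mk ℝ ℂ 𝔤 (-(starRingEnd ℂ) (alpha a))) ∘ₗ (L.gr a).subtype)
    ∘ₗ (LinearEquiv.ofBijective (DirectSum.coeLinearMap L.gr) L.isInternal).symm.toLinearMap

theorem starReal_apply {a : Gam n} {x : 𝔤} (hx : x ∈ L.gr a) :
    L.starReal x = (-(starRingEnd ℂ) (alpha a)) ⊗ₜ x := by
  have h : (LinearEquiv.ofBijective (DirectSum.coeLinearMap L.gr) L.isInternal).symm x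
      = DirectSum.lof ℝ (Gam n) (fun a => L.gr a) a ⟨x, hx⟩ := by
    rw [LinearEquiv.symm_apply_eq]
    exact (DirectSum.coeLinearMap_lof L.gr a ⟨x, hx⟩).symm
  rw [starReal, LinearMap.comp_apply]
  refine (congrArg _ h).trans ?_
  rw [DirectSum.toModule_lof]
  rfl

/-- The conjugate-linear map `x ↦ x*` on `𝔤_ℂ`. -/
def starC : (ℂ ⊗[ℝ] 𝔤) →ₗ⋆[ℂ] (ℂ ⊗[ℝ] 𝔤) where
  toFun := TensorProduct.lift (LinearMap.mk₂ ℝ (fun (z : ℂ) (x : 𝔤) =>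
      (starRingEnd ℂ) z • L.starReal x)
    (fun z z' x => by rw [map_add, add_smul])
    (fun r z x => by
      rw [Complex.real_smul, map_mul, Complex.conj_ofReal, mul_smul]; rfl)
    (fun z x y => by rw [map_add, smul_add])
    (fun r z x => by rw [map_smul, smul_comm]))
  map_add' x y := map_add _ x y
  map_smul' c x := by
    induction x using TensorProduct.induction_on with
    | zero => simp
    | tmul z x => simp [TensorProduct.smul_tmul', mul_smul]
    | add x y hx hy => rw [smul_add, map_add, map_add, hx, hy, smul_add]

theorem starC_tmul (z : ℂ) {a : Gam n} {x : 𝔤} (hx : x ∈ L.gr a) :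
    L.starC (z ⊗ₜ x) = (-(starRingEnd ℂ) (z * alpha a)) ⊗ₜ x := by
  change (starRingEnd ℂ) z • L.starReal x = _
  rw [L.starReal_apply hx, TensorProduct.smul_tmul', smul_eq_mul, map_mul, mul_neg]

end LieSuperalgebra

/-- The opposite of a complex algebra, with the conjugate complex structure. -/
def ConjOp (A : Type*) : Type _ := Aᵐᵒᵖ

instance {A : Type*} [Ring A] : Ring (ConjOp A) := inferInstanceAs (Ring Aᵐᵒᵖ)

instance {A : Type*} [Ring A] [Algebra ℂ A] : Algebra ℂ (ConjOp A) :=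
  RingHom.toAlgebra' ((algebraMap ℂ Aᵐᵒᵖ).comp (starRingEnd ℂ))
    (fun c x => Algebra.commutes (A := Aᵐᵒᵖ) ((starRingEnd ℂ) c) x)

/-- The additive bijection from `A` to its conjugate opposite. -/
def toConjOp {A : Type*} [Ring A] : A ≃+ ConjOp A := MulOpposite.opAddEquiv

theorem toConjOp_smul {A : Type*} [Ring A] [Algebra ℂ A] (c : ℂ) (x : A) :
    toConjOp ((starRingEnd ℂ) c • x) = c • toConjOp x := by
  rw [Algebra.smul_def c (toConjOp x), Algebra.smul_def, Algebra.commutes]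
  rfl

theorem toConjOp_mul {A : Type*} [Ring A] (x y : A) :
    toConjOp (x * y) = toConjOp y * toConjOp x := rfl

namespace LieSuperalgebra

variable {n : ℕ} {𝔤 : Type*} [AddCommGroup 𝔤] [Module ℝ 𝔤] (L : LieSuperalgebra n 𝔤)

/-- The extension of `x ↦ x*` to an algebra homomorphism from `𝔘(𝔤_ℂ)` to its conjugate
opposite. -/
def starHom : L.UEA →ₐ[ℂ] ConjOp L.UEA :=
  L.lift
    { toFun := fun x => toConjOp (L.ι (L.starC x))
      map_add' := fun x y => by rw [map_add, map_add, map_add]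
      map_smul' := fun c x => by
        rw [LinearMap.map_smulₛₗ, map_smul, toConjOp_smul]; rfl }
    (by
      intro a b x y hx hy
      have e : ∀ (c : ℂ) (w : 𝔤), L.ι (c ⊗ₜ w) = c • L.ι (1 ⊗ₜ w) := by
        intro c w
        rw [← map_smul, TensorProduct.smul_tmul', smul_eq_mul, mul_one]
      change toConjOp (L.ι (L.starC (1 ⊗ₜ x))) * toConjOp (L.ι (L.starC (1 ⊗ₜ y)))
        - beta a b • (toConjOp (L.ι (L.starC (1 ⊗ₜ y))) * toConjOp (L.ι (L.starC (1 ⊗ₜ x))))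
        = toConjOp (L.ι (L.starC (1 ⊗ₜ L.bracket x y)))
      rw [L.starC_tmul 1 hx, L.starC_tmul 1 hy, L.starC_tmul 1 (L.bracket_mem a b x y hx hy),
        ← toConjOp_mul, ← toConjOp_mul, ← map_zsmul, ← map_sub]
      congr 1
      rw [e _ x, e _ y, e _ (L.bracket x y), ← L.ι_rel a b x y hx hy, alpha_add]
      have hb : (beta a b : ℂ) * (beta a b : ℂ) = 1 := by exact_mod_cast beta_mul_self a b
      simp only [one_mul, map_mul, map_intCast, smul_mul_smul_comm, neg_mul_neg, smul_sub,
        ← Int.cast_smul_eq_zsmul ℂ, smul_smul]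
      generalize (starRingEnd ℂ) (alpha a) = p
      generalize (starRingEnd ℂ) (alpha b) = q
      have h1 : -((beta a b : ℂ) * (p * q)) * (beta a b : ℂ) = -(p * q) := by
        linear_combination (-(p * q)) * hb
      rw [h1, mul_comm q p, neg_smul, neg_smul]
      abel)

/-- The conjugate-linear anti-automorphism `D ↦ D*` of `𝔘(𝔤_ℂ)` extending `x ↦ x*`. -/
def starU (D : L.UEA) : L.UEA := toConjOp.symm (L.starHom D)

theorem starU_ι (x : ℂ ⊗[ℝ] 𝔤) : L.starU (L.ι x) = L.ι (L.starC x) := by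
  rw [starU, starHom, lift_ι]; exact toConjOp.symm_apply_apply _

theorem starU_mul (D D' : L.UEA) : L.starU (D * D') = L.starU D' * L.starU D := by
  unfold starU; rw [map_mul]; rfl

theorem starU_add (D D' : L.UEA) : L.starU (D + D') = L.starU D + L.starU D' := by
  unfold starU; rw [map_add, map_add]

theorem starU_smul (c : ℂ) (D : L.UEA) : L.starU (c • D) = (starRingEnd ℂ) c • L.starU D := by
  unfold starU
  rw [map_smul, AddEquiv.symm_apply_eq, toConjOp_smul, AddEquiv.apply_symm_apply]

end LieSuperalgebra

/-! ### `Γ`-Harish-Chandra pairs and the monoid `𝒮` -/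

section LieGroup

variable {E : Type*} [NormedAddCommGroup E] [NormedSpace ℝ E]
variable (G : Type*) [TopologicalSpace G] [ChartedSpace E G] [Group G]

/-- The Lie algebra of `G`: the tangent space at the identity, with the bracket of left invariant
vector fields. -/
abbrev LieOf : Type _ := GroupLieAlgebra 𝓘(ℝ, E) G

variable {G}

/-- The adjoint action of `g` on `Lie(G)`: the differential at `1` of `h ↦ g h g⁻¹`
(which maps `1` to `1`). -/
def adjointAction (g : G) : LieOf (E := E) G →L[ℝ] LieOf (E := E) G :=
  mfderiv 𝓘(ℝ, E) 𝓘(ℝ, E) (fun h : G => g * h * g⁻¹) 1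

/-- `γ(t) = exp(t ξ)`: the integral curve through `1` of the left invariant vector field of `ξ`. -/
def IsExpCurve (ξ : LieOf (E := E) G) (γ : ℝ → G) : Prop :=
  γ 0 = 1 ∧ IsMIntegralCurve (I := 𝓘(ℝ, E)) γ (mulInvariantVectorField ξ)

/-- The left invariant differential operator of `ξ ∈ Lie(G)` on functions `h : G → ℂ`. -/
def leftDeriv (ξ : LieOf (E := E) G) (h : G → ℂ) (g : G) : ℂ :=
  mfderiv 𝓘(ℝ, E) 𝓘(ℝ, ℂ) h g (mulInvariantVectorField ξ g)

variable (E G) in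
/-- The space `C^∞(G; ℂ)`. -/
def smoothFunctions : Submodule ℂ (G → ℂ) where
  carrier := {h | ContMDiff 𝓘(ℝ, E) 𝓘(ℝ, ℂ) ∞ h}
  zero_mem' := contMDiff_const
  add_mem' hf hg := hf.add hg
  smul_mem' c _ hh :=
    ((c • (ContinuousLinearMap.id ℝ ℂ)).contDiff.contMDiff (n := ∞)).comp hh

end LieGroup

/-- A `Γ`-Harish-Chandra pair `(G, 𝔤)`: a `Γ`-Lie superalgebra `𝔤` with an identification of
`𝔤_0` with `Lie(G)` and an action `Ad` of `G` on `𝔤` by automorphisms of the `Γ`-Lie superalgebra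
which extends the adjoint action of `G` on `𝔤_0`. -/
structure HCPair (n : ℕ) {E : Type*} [NormedAddCommGroup E] [NormedSpace ℝ E]
    (G : Type*) [TopologicalSpace G] [ChartedSpace E G] [Group G]
    (𝔤 : Type*) [AddCommGroup 𝔤] [Module ℝ 𝔤] extends LieSuperalgebra n 𝔤 where
  /-- the identification `Lie(G) ≅ 𝔤_0` -/
  lieEquiv : LieOf (E := E) G ≃ₗ[ℝ] gr 0
  lieEquiv_bracket : ∀ ξ η : LieOf (E := E) G,
    (lieEquiv ⁅ξ, η⁆ : 𝔤) = bracket (lieEquiv ξ) (lieEquiv η)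
  Ad : G →* Module.End ℝ 𝔤
  Ad_mem : ∀ (g : G) (a : Gam n) (x : 𝔤), x ∈ gr a → Ad g x ∈ gr a
  Ad_bracket : ∀ (g : G) (x y : 𝔤), Ad g (bracket x y) = bracket (Ad g x) (Ad g y)
  Ad_lieEquiv : ∀ (g : G) (ξ : LieOf (E := E) G),
    Ad g (lieEquiv ξ) = lieEquiv (adjointAction g ξ)

namespace HCPair

variable {n : ℕ} {E : Type*} [NormedAddCommGroup E] [NormedSpace ℝ E]
  {G : Type*} [TopologicalSpace G] [ChartedSpace E G] [Group G]
  {𝔤 : Type*} [AddCommGroup 𝔤] [Module ℝ 𝔤] (P : HCPair n (E := E) G 𝔤)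

/-- The enveloping algebra `𝔘(𝔤_ℂ)` of the pair. -/
abbrev U : Type _ := P.toLieSuperalgebra.UEA

/-- The automorphism of `𝔘(𝔤_ℂ)` which extends `Ad(g)`. -/
def AdU (g : G) : P.U →ₐ[ℂ] P.U :=
  P.lift (P.ι ∘ₗ (P.Ad g).baseChange ℂ) (by
    intro a b x y hx hy
    simpa [P.Ad_bracket] using
      P.ι_rel a b (P.Ad g x) (P.Ad g y) (P.Ad_mem g a x hx) (P.Ad_mem g b y hy))

theorem AdU_ι (g : G) (x : 𝔤) : P.AdU g (P.ι (1 ⊗ₜ x)) = P.ι (1 ⊗ₜ P.Ad g x) := by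
  rw [AdU, LieSuperalgebra.lift_ι]; simp

theorem AdU_one : P.AdU 1 = AlgHom.id ℂ P.U :=
  P.algHom_ext _ _ fun x => by rw [AdU_ι, map_one]; rfl

theorem AdU_mul (g h : G) : P.AdU (g * h) = (P.AdU g).comp (P.AdU h) :=
  P.algHom_ext _ _ fun x => by
    rw [AdU_ι, map_mul, AlgHom.comp_apply, AdU_ι, AdU_ι]; rfl

/-- The underlying set of the monoid `𝒮 = G ⋉ 𝔘(𝔤_ℂ)`. -/
@[ext] structure SMonoid where
  g : G
  D : P.U

/-- `(g₁, D₁)(g₂, D₂) = (g₁ g₂, (Ad(g₂⁻¹) D₁) D₂)`. -/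
instance : Monoid P.SMonoid where
  mul s t := ⟨s.g * t.g, P.AdU t.g⁻¹ s.D * t.D⟩
  one := ⟨1, 1⟩
  mul_assoc s t r := by
    refine SMonoid.ext (mul_assoc _ _ _) ?_
    change P.AdU r.g⁻¹ (P.AdU t.g⁻¹ s.D * t.D) * r.D
      = P.AdU (t.g * r.g)⁻¹ s.D * (P.AdU r.g⁻¹ t.D * r.D)
    rw [map_mul, mul_inv_rev, AdU_mul, AlgHom.comp_apply, mul_assoc]
  one_mul s := by
    refine SMonoid.ext (one_mul _) ?_
    change P.AdU s.g⁻¹ 1 * s.D = s.D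
    rw [map_one, one_mul]
  mul_one s := by
    refine SMonoid.ext (mul_one _) ?_
    change P.AdU (1 : G)⁻¹ s.D * 1 = s.D
    rw [inv_one, AdU_one, mul_one]; rfl

/-- The involution `(g, D)* = (g⁻¹, Ad(g)(D*))` of `𝒮`. -/
instance : Star P.SMonoid where
  star s := ⟨s.g⁻¹, P.AdU s.g (P.starU s.D)⟩

/-- `𝒮_a`, the set of all `(g, D) ∈ 𝒮` with `D` homogeneous of degree `a`. -/
def SDeg (a : Gam n) : Set P.SMonoid := {s | s.D ∈ P.grU a}

/-! ### Smooth functions on the supergroup -/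

/-- `C^∞(𝒢) = Hom_{𝔤_0}(𝔘(𝔤_ℂ), C^∞(G; ℂ))`, where `𝔤_0 = Lie(G)` acts on `𝔘(𝔤_ℂ)` by left
multiplication and on `C^∞(G; ℂ)` by left invariant differential operators. -/
structure SuperFunction where
  toLin : P.U →ₗ[ℂ] smoothFunctions E G
  equivariant : ∀ (ξ : LieOf (E := E) G) (D : P.U),
    (toLin (P.ι (1 ⊗ₜ (P.lieEquiv ξ : 𝔤)) * D) : G → ℂ) = leftDeriv ξ (toLin D : G → ℂ)

variable {P}

/-- The function `f̌(g, D) = f(D)(g)` on `𝒮`. -/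
def SuperFunction.check (f : P.SuperFunction) (s : P.SMonoid) : ℂ := (f.toLin s.D : G → ℂ) s.g

/-- Positive definiteness of `f ∈ C^∞(𝒢)`. Condition (i) is about homogeneous `(g, D)`: `f̌(g, D)`
vanishes if `D` is homogeneous of non-zero degree. In (ii), `0 ≤ z` for complex `z` means that
`z` is real and non-negative. -/
structure SuperFunction.IsPosDef (f : P.SuperFunction) : Prop where
  support : ∀ a : Gam n, a ≠ 0 → ∀ s ∈ P.SDeg a, f.check s = 0
  nonneg : ∀ (m : ℕ) (c : Fin m → ℂ) (s : Fin m → P.SMonoid),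
    0 ≤ ∑ i, ∑ j, (starRingEnd ℂ) (c i) * c j * f.check (star (s i) * s j)

end HCPair

/-! ### `Γ`-graded Hilbert spaces and unitary representations -/

/-- The structure of a `Γ`-graded Hilbert space on a complex Hilbert space `ℋ`: a `Γ`-grading and
a `Γ`-inner product `⟨·, ·⟩` (linear in the first variable) whose associated ordinary inner
product `(v, w)`, equal to `α(a) ⟨v, w⟩` for `v, w ∈ ℋ_a` and to `0` for `v`, `w` of different
degrees, is the inner product of `ℋ`. Mathlib's `inner ℂ w v` is `(v, w)`. -/
structure GradedHilbert (n : ℕ) (ℋ : Type*) [NormedAddCommGroup ℋ] [InnerProductSpace ℂ ℋ] where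
  /-- the homogeneous component `ℋ_a` -/
  gr : Gam n → Submodule ℂ ℋ
  isInternal : DirectSum.IsInternal gr
  /-- the `Γ`-inner product -/
  form : ℋ →ₗ[ℂ] ℋ →ₗ⋆[ℂ] ℂ
  form_orthogonal : ∀ (a b : Gam n) (v w : ℋ), a ≠ b → v ∈ gr a → w ∈ gr b → form v w = 0
  form_symm : ∀ (a : Gam n) (v w : ℋ), v ∈ gr a → w ∈ gr a →
    form w v = (beta a a : ℂ) * (starRingEnd ℂ) (form v w)
  form_nonneg : ∀ (a : Gam n) (v : ℋ), v ∈ gr a → 0 ≤ alpha a * form v v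
  inner_eq : ∀ (a : Gam n) (v w : ℋ), v ∈ gr a → w ∈ gr a → inner ℂ w v = alpha a * form v w
  inner_orthogonal : ∀ (a b : Gam n) (v w : ℋ), a ≠ b → v ∈ gr a → w ∈ gr b → inner ℂ w v = 0

section Smooth

variable {E : Type*} [NormedAddCommGroup E] [NormedSpace ℝ E]
  {G : Type*} [TopologicalSpace G] [ChartedSpace E G] [Group G]
  {ℋ : Type*} [NormedAddCommGroup ℋ] [InnerProductSpace ℂ ℋ]

variable (E) in
/-- The space `ℋ^∞` of smooth vectors of a unitary representation `π` of `G` on `ℋ`. -/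
def smoothVectors (π : G →* (ℋ ≃ₗᵢ[ℂ] ℋ)) : Submodule ℂ ℋ where
  carrier := {v | ContMDiff 𝓘(ℝ, E) 𝓘(ℝ, ℋ) ∞ fun g : G => π g v}
  zero_mem' := by
    simp only [Set.mem_ofPred_eq, map_zero]
    exact contMDiff_const
  add_mem' {v w} hv hw := by
    simp only [Set.mem_ofPred_eq, map_add] at *
    exact hv.add hw
  smul_mem' c v hv := by
    simp only [Set.mem_ofPred_eq, map_smul] at *
    exact ((c • (ContinuousLinearMap.id ℝ ℋ)).contDiff.contMDiff (n := ∞)).comp hv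

theorem apply_mem_smoothVectors [LieGroup 𝓘(ℝ, E) ∞ G] (π : G →* (ℋ ≃ₗᵢ[ℂ] ℋ)) (g : G) {v : ℋ}
    (hv : v ∈ smoothVectors E π) : π g v ∈ smoothVectors E π := by
  have hv' : ContMDiff 𝓘(ℝ, E) 𝓘(ℝ, ℋ) ∞ fun h : G => π h v := hv
  have h2 : ContMDiff 𝓘(ℝ, E) 𝓘(ℝ, ℋ) ∞ fun h : G => π (h * g) v :=
    hv'.comp (contMDiff_mul_right (I := 𝓘(ℝ, E)) (n := ∞) (a := g))
  have h3 : (fun h : G => π (h * g) v) = fun h : G => π h (π g v) := by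
    funext h
    rw [map_mul]; rfl
  rw [h3] at h2
  exact h2

/-- The restriction of `π(g)` to `ℋ^∞`. -/
def piSmooth [LieGroup 𝓘(ℝ, E) ∞ G] (π : G →* (ℋ ≃ₗᵢ[ℂ] ℋ)) (g : G) :
    Module.End ℂ (smoothVectors E π) :=
  (π g).toLinearEquiv.toLinearMap.restrict fun _ hv => apply_mem_smoothVectors π g hv

/-- `u = dπ(ξ) v`, that is, `u` is the limit of `t⁻¹ (π(exp(t ξ)) v - v)` as `t → 0`. -/
def IsDerivedValue (π : G →* (ℋ ≃ₗᵢ[ℂ] ℋ)) (ξ : LieOf (E := E) G) (v u : ℋ) : Prop :=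
  ∃ γ : ℝ → G, IsExpCurve ξ γ ∧
    Filter.Tendsto (fun t : ℝ => t⁻¹ • (π (γ t) v - v)) (nhdsWithin 0 {0}ᶜ) (nhds u)

end Smooth

/-- A smooth unitary representation `(π, ρ, ℋ)` of a `Γ`-Harish-Chandra pair `(G, 𝔤)` on a
`Γ`-graded Hilbert space `ℋ`. -/
structure UnitaryRep {n : ℕ} {E : Type*} [NormedAddCommGroup E] [NormedSpace ℝ E]
    {G : Type*} [TopologicalSpace G] [ChartedSpace E G] [Group G] [LieGroup 𝓘(ℝ, E) ∞ G]
    {𝔤 : Type*} [AddCommGroup 𝔤] [Module ℝ 𝔤] (P : HCPair n (E := E) G 𝔤)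
    {ℋ : Type*} [NormedAddCommGroup ℋ] [InnerProductSpace ℂ ℋ] (W : GradedHilbert n ℋ) where
  π : G →* (ℋ ≃ₗᵢ[ℂ] ℋ)
  /-- (R1) `π` is strongly continuous, its smooth vectors are dense, and it preserves the
  grading -/
  continuous_orbit : ∀ v : ℋ, Continuous fun g : G => π g v
  dense_smooth : Dense (smoothVectors E π : Set ℋ)
  π_mem : ∀ (g : G) (a : Gam n) (v : ℋ), v ∈ W.gr a → π g v ∈ W.gr a
  /-- (R2) `ρ` is a representation of the `Γ`-Lie superalgebra `𝔤` on `ℋ^∞` -/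
  ρ : 𝔤 →ₗ[ℝ] Module.End ℂ (smoothVectors E π)
  ρ_mem : ∀ (a b : Gam n) (x : 𝔤) (v : smoothVectors E π), x ∈ P.gr a → (v : ℋ) ∈ W.gr b →
    (ρ x v : ℋ) ∈ W.gr (a + b)
  ρ_bracket : ∀ (a b : Gam n) (x y : 𝔤), x ∈ P.gr a → y ∈ P.gr b →
    ρ (P.bracket x y) = ρ x * ρ y - beta a b • (ρ y * ρ x)
  /-- (R3) `ρ(x) = dπ(x)` on `ℋ^∞` for `x ∈ 𝔤_0` -/
  ρ_even : ∀ (ξ : LieOf (E := E) G) (v : smoothVectors E π),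
    IsDerivedValue π ξ (v : ℋ) (ρ (P.lieEquiv ξ) v : ℋ)
  /-- (R4) `ρ(x)† = -ρ(x)`, where for `T` of degree `a` the adjoint `T†` is given by
  `⟨v, T w⟩ = β(a, b) ⟨T† v, w⟩` for `v` of degree `b` -/
  ρ_adjoint : ∀ (a b : Gam n) (x : 𝔤) (v w : smoothVectors E π), x ∈ P.gr a → (v : ℋ) ∈ W.gr b →
    W.form (v : ℋ) (ρ x w : ℋ) = (beta a b : ℂ) * W.form ((-(ρ x)) v : ℋ) (w : ℋ)
  /-- (R5) `π(g) ρ(x) π(g)⁻¹ = ρ(Ad(g) x)` -/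
  ρ_Ad : ∀ (g : G) (x : 𝔤), piSmooth π g * ρ x * piSmooth π g⁻¹ = ρ (P.Ad g x)

namespace UnitaryRep

variable {n : ℕ} {E : Type*} [NormedAddCommGroup E] [NormedSpace ℝ E]
  {G : Type*} [TopologicalSpace G] [ChartedSpace E G] [Group G] [LieGroup 𝓘(ℝ, E) ∞ G]
  {𝔤 : Type*} [AddCommGroup 𝔤] [Module ℝ 𝔤] {P : HCPair n (E := E) G 𝔤}
  {ℋ : Type*} [NormedAddCommGroup ℋ] [InnerProductSpace ℂ ℋ] {W : GradedHilbert n ℋ}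
  (R : UnitaryRep P W)

/-- The extension of `ρ` to a representation of the algebra `𝔘(𝔤_ℂ)` on `ℋ^∞`. -/
def ρU : P.U →ₐ[ℂ] Module.End ℂ (smoothVectors E R.π) :=
  P.lift (LinearMap.liftBaseChange ℂ R.ρ) (by
    intro a b x y hx hy
    simp only [LinearMap.liftBaseChange_tmul, one_smul]
    exact (R.ρ_bracket a b x y hx hy).symm)

/-- The matrix coefficient `φ_{v,w}(g, D) = (π(g) ρ(D) v, w)` on `𝒮`. -/
def matrixCoeff (v w : smoothVectors E R.π) (s : P.SMonoid) : ℂ :=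
  inner ℂ (w : ℋ) (R.π s.g (R.ρU s.D v : ℋ))

end UnitaryRep

end GammaSuper

end

/-!
The function is `f(D)(g) = (π(g) ρ(D) v, w)`, which is smooth in `g` because `ρ(D) v` is a smooth
vector.

* *Equivariance* (`UnitaryRep.leftDeriv_inner`). Let `ξ ∈ Lie(G)` and let `γ` be the curve
  `exp(t ξ)`. The derivative at `t = 0` of `t ↦ (π(g γ(t)) u, w)` is `L_ξ` of the matrix
  coefficient by the chain rule, since `g γ` has velocity the left invariant field of `ξ`; and it
  is `(π(g) ρ(ξ) u, w)`, since `ρ(ξ) u` is the derivative of `π(γ(t)) u`.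
* *Support* (`UnitaryRep.rhoU_mem`). If `D` is homogeneous of degree `a`, then `ρ(D)` shifts
  degrees by `a`, and different components of `ℋ` are orthogonal.
* *Positivity* (`UnitaryRep.inner_star_mul`). One has `ρ(Ad(g) D) = π(g) ρ(D) π(g)⁻¹`, and
  `ρ(D*)` is the formal adjoint of `ρ(D)` for the ordinary inner product
  (`UnitaryRep.inner_rhoU_left`): for `x ∈ 𝔤_a` the factor `-conj(α(a))` in `x*` is what turns
  `ρ(x)† = -ρ(x)` into an ordinary adjoint, because of `α(a + b) = β(a, b) α(a) α(b)`. Hence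
  `f̌(s* t) = (t·v, s·v)` for the action `(g, D) ↦ π(g) ρ(D)` of `𝒮`, and the sum in the
  definition of positive definiteness is a squared norm.

The condition on `ρ(x)†` speaks only of homogeneous vectors. The adjoint relation is therefore
proved on the span of the homogeneous smooth vectors, which is stable under `𝔘(𝔤_ℂ)`; this
suffices since `v` is homogeneous.
-/

open scoped ContDiff Manifold TensorProduct ComplexOrder

namespace GammaSuper

/-! ### The enveloping algebra and the graded inner product -/

/-- Induction on `𝔘(𝔤_ℂ)`: it suffices to treat scalars and the homogeneous elements of the real
form `𝔤`, and to pass to products and sums. -/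
theorem LieSuperalgebra.UEA_induction {n : ℕ} {𝔤 : Type*} [AddCommGroup 𝔤] [Module ℝ 𝔤]
    (L : LieSuperalgebra n 𝔤) {C : L.UEA → Prop}
    (algebraMap : ∀ c : ℂ, C (algebraMap ℂ L.UEA c))
    (ι : ∀ (a : Gam n) (x : 𝔤), x ∈ L.gr a → C (L.ι (1 ⊗ₜ x)))
    (mul : ∀ D D', C D → C D' → C (D * D'))
    (add : ∀ D D', C D → C D' → C (D + D')) (D : L.UEA) : C D := by
  have smul : ∀ (c : ℂ) D, C D → C (c • D) := fun c D h => by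
    rw [Algebra.smul_def]; exact mul _ _ (algebraMap c) h
  have zero : C 0 := by simpa using algebraMap 0
  have key : ∀ x : 𝔤, C (L.ι (1 ⊗ₜ x)) := fun x => by
    have hx : x ∈ ⨆ a, L.gr a := by
      rw [L.isInternal.submodule_iSup_eq_top]; trivial
    induction hx using Submodule.iSup_induction' with
    | mem a x hx => exact ι a x hx
    | zero => simpa using zero
    | add x y _ _ hx hy => rw [TensorProduct.tmul_add, map_add]; exact add _ _ hx hy
  obtain ⟨T, rfl⟩ := RingQuot.mkAlgHom_surjective ℂ L.UEARel D
  induction T using TensorAlgebra.induction with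
  | algebraMap c => rw [AlgHom.commutes]; exact algebraMap c
  | ι y =>
    change C (L.ι y)
    induction y using TensorProduct.induction_on with
    | zero => simpa using zero
    | tmul z x =>
      have hz : (z ⊗ₜ[ℝ] x : ℂ ⊗[ℝ] 𝔤) = z • ((1 : ℂ) ⊗ₜ[ℝ] x) := by
        rw [TensorProduct.smul_tmul', smul_eq_mul, mul_one]
      rw [hz, map_smul]
      exact smul z _ (key x)
    | add x y hx hy => rw [map_add]; exact add _ _ hx hy
  | mul S T hS hT => rw [map_mul]; exact mul _ _ hS hT
  | add S T hS hT => rw [map_add]; exact add _ _ hS hT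

theorem LieSuperalgebra.starU_algebraMap {n : ℕ} {𝔤 : Type*} [AddCommGroup 𝔤] [Module ℝ 𝔤]
    (L : LieSuperalgebra n 𝔤) (c : ℂ) :
    L.starU (algebraMap ℂ L.UEA c) = algebraMap ℂ L.UEA ((starRingEnd ℂ) c) := by
  have h1 : L.starU 1 = 1 := by
    unfold starU; rw [map_one]; rfl
  rw [Algebra.algebraMap_eq_smul_one, starU_smul, h1,
    ← Algebra.algebraMap_eq_smul_one]

/-- The relation between the two forms needs only one homogeneous argument, since both vanish on
the components of `u` of other degrees. -/
theorem GradedHilbert.inner_eq_alpha_mul_form {n : ℕ} {ℋ : Type*} [NormedAddCommGroup ℋ]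
    [InnerProductSpace ℂ ℋ] (W : GradedHilbert n ℋ) {b : Gam n} {y : ℋ} (hy : y ∈ W.gr b)
    (u : ℋ) : inner ℂ u y = alpha b * W.form y u := by
  have hu : u ∈ ⨆ a, W.gr a := by
    rw [W.isInternal.submodule_iSup_eq_top]; trivial
  induction hu using Submodule.iSup_induction' with
  | mem a u hu =>
    rcases eq_or_ne b a with rfl | h
    · exact W.inner_eq b y u hy hu
    · rw [W.inner_orthogonal b a y u h hy hu, W.form_orthogonal b a y u h hy hu, mul_zero]
  | zero => simp
  | add x y _ _ hx hy => rw [inner_add_left, hx, hy, map_add, mul_add]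

/-! ### Left invariant derivatives -/

section Curves

variable {E : Type*} [NormedAddCommGroup E] [NormedSpace ℝ E]
  {G : Type*} [TopologicalSpace G] [ChartedSpace E G] [Group G] [LieGroup 𝓘(ℝ, E) ∞ G]

/-- The left invariant derivative is the derivative along the translated one-parameter group
`t ↦ g exp(t ξ)`. -/
theorem hasDerivAt_comp_mul_expCurve {ξ : LieOf (E := E) G} {γ : ℝ → G} (hγ : IsExpCurve ξ γ)
    {h : G → ℂ} {g : G} (hh : MDifferentiableAt 𝓘(ℝ, E) 𝓘(ℝ, ℂ) h g) :
    HasDerivAt (fun t => h (g * γ t)) (leftDeriv ξ h g) 0 := by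
  obtain ⟨h0, hc⟩ := hγ
  have h1 : HasMFDerivAt 𝓘(ℝ, ℝ) 𝓘(ℝ, E) γ 0
      ((1 : ℝ →L[ℝ] ℝ).smulRight (mulInvariantVectorField ξ (γ 0))) := hc 0
  have h2 : HasMFDerivAt 𝓘(ℝ, E) 𝓘(ℝ, E) (fun x : G => g * x) (γ 0)
      (mfderiv 𝓘(ℝ, E) 𝓘(ℝ, E) (fun x : G => g * x) (γ 0)) :=
    ((contMDiff_mul_left (I := 𝓘(ℝ, E)) (n := ∞) (a := g)).mdifferentiable (by simp)
      (γ 0)).hasMFDerivAt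
  have h3 : HasMFDerivAt 𝓘(ℝ, E) 𝓘(ℝ, ℂ) h (g * γ 0) (mfderiv 𝓘(ℝ, E) 𝓘(ℝ, ℂ) h (g * γ 0)) := by
    rw [h0, mul_one]; exact hh.hasMFDerivAt
  have h4 := (h3.comp (γ 0) h2).comp 0 h1
  have h5 : HasFDerivAt (fun t => h (g * γ t)) (_ : ℝ →L[ℝ] ℂ) 0 :=
    hasMFDerivAt_iff_hasFDerivAt.1 h4
  convert h5.hasDerivAt using 1
  change leftDeriv ξ h g = mfderiv 𝓘(ℝ, E) 𝓘(ℝ, ℂ) h (g * γ 0)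
    (mfderiv 𝓘(ℝ, E) 𝓘(ℝ, E) (fun x : G => g * x) (γ 0)
      ((1 : ℝ) • mulInvariantVectorField ξ (γ 0)))
  rw [h0, one_smul]
  have h6 : mulInvariantVectorField (I := 𝓘(ℝ, E)) ξ (1 : G) = ξ := by
    have h7 : (fun x : G => 1 * x) = id := funext one_mul
    rw [mulInvariantVectorField, h7, mfderiv_id]
    rfl
  rw [h6, mul_one]
  rfl

end Curves

namespace UnitaryRep

variable {n : ℕ} {E : Type*} [NormedAddCommGroup E] [NormedSpace ℝ E]
  {G : Type*} [TopologicalSpace G] [ChartedSpace E G] [Group G] [LieGroup 𝓘(ℝ, E) ∞ G]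
  {𝔤 : Type*} [AddCommGroup 𝔤] [Module ℝ 𝔤] {P : HCPair n (E := E) G 𝔤}
  {ℋ : Type*} [NormedAddCommGroup ℋ] [InnerProductSpace ℂ ℋ] {W : GradedHilbert n ℋ}
  (R : UnitaryRep P W)

/-! ### Matrix coefficients as smooth functions -/

theorem contMDiff_inner (w : ℋ) (u : smoothVectors E R.π) :
    ContMDiff 𝓘(ℝ, E) 𝓘(ℝ, ℂ) ∞ fun g : G => inner ℂ w (R.π g (u : ℋ)) := by
  have hu : ContMDiff 𝓘(ℝ, E) 𝓘(ℝ, ℋ) ∞ fun g : G => R.π g (u : ℋ) := u.2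
  exact ((innerSL ℂ w).restrictScalars ℝ).contDiff.contMDiff.comp hu

theorem leftDeriv_inner (ξ : LieOf (E := E) G) (w : ℋ) (u : smoothVectors E R.π) (g : G) :
    leftDeriv ξ (fun g : G => inner ℂ w (R.π g (u : ℋ))) g
      = inner ℂ w (R.π g (R.ρ (P.lieEquiv ξ) u : ℋ)) := by
  obtain ⟨γ, hγ, hlim⟩ := R.ρ_even ξ u
  have h1 := hasDerivAt_comp_mul_expCurve hγ
    ((R.contMDiff_inner w u).mdifferentiable (by simp) g)
  have h2 : HasDerivAt (fun t => R.π (γ t) (u : ℋ)) (R.ρ (P.lieEquiv ξ) u : ℋ) 0 := by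
    rw [hasDerivAt_iff_tendsto_slope_zero]
    simpa [hγ.1] using hlim
  have h3 := (((innerSL ℂ w).comp
    (R.π g).toContinuousLinearEquiv.toContinuousLinearMap).restrictScalars ℝ).hasFDerivAt
      (x := R.π (γ 0) (u : ℋ)) |>.comp_hasDerivAt 0 h2
  refine h1.unique (h3.congr_of_eventuallyEq (.of_forall fun t => ?_))
  simp [map_mul]

theorem rhoU_ι (x : 𝔤) : R.ρU (P.ι (1 ⊗ₜ x)) = R.ρ x := by
  rw [ρU, LieSuperalgebra.lift_ι]; simp

/-- The element of `C^∞(𝒢)` given by a matrix coefficient: `f(D)(g) = (π(g) ρ(D) v, w)`. -/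
noncomputable def coeffFunction (v w : smoothVectors E R.π) : P.SuperFunction where
  toLin :=
    { toFun := fun D => ⟨fun g => inner ℂ (w : ℋ) (R.π g (R.ρU D v : ℋ)), R.contMDiff_inner _ _⟩
      map_add' := fun D D' => Subtype.ext <| funext fun g => by
        change inner ℂ (w : ℋ) (R.π g (R.ρU (D + D') v : ℋ)) = _ + _
        rw [map_add, LinearMap.add_apply, Submodule.coe_add, map_add, inner_add_right]
      map_smul' := fun c D => Subtype.ext <| funext fun g => by
        change inner ℂ (w : ℋ) (R.π g (R.ρU (c • D) v : ℋ)) = c * _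
        rw [map_smul, LinearMap.smul_apply, Submodule.coe_smul, map_smul, inner_smul_right] }
  equivariant ξ D := funext fun g => by
    refine Eq.trans ?_ (R.leftDeriv_inner ξ w (R.ρU D v) g).symm
    simp [map_mul, rhoU_ι]

theorem check_coeffFunction (v w : smoothVectors E R.π) (s : P.SMonoid) :
    (R.coeffFunction v w).check s = R.matrixCoeff v w s := rfl

/-! ### Degrees -/

theorem rhoU_ι_mem {a b : Gam n} {x : ℂ ⊗[ℝ] 𝔤} (hx : x ∈ P.grC a) {u : smoothVectors E R.π}
    (hu : (u : ℋ) ∈ W.gr b) : (R.ρU (P.ι x) u : ℋ) ∈ W.gr (a + b) := by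
  rw [LieSuperalgebra.grC, Submodule.baseChange_eq_span] at hx
  induction hx using Submodule.span_induction with
  | mem x hx =>
    obtain ⟨x, hx, rfl⟩ := hx
    have := R.ρ_mem a b x u hx hu
    rw [← rhoU_ι] at this
    exact this
  | zero => simp
  | add x y _ _ hx hy => simpa using add_mem hx hy
  | smul c x _ hx => simpa using Submodule.smul_mem _ c hx

theorem rhoU_mem {a b : Gam n} {D : P.U} (hD : D ∈ P.grU a) {u : smoothVectors E R.π}
    (hu : (u : ℋ) ∈ W.gr b) : (R.ρU D u : ℋ) ∈ W.gr (a + b) := by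
  induction hD using Submodule.span_induction with
  | mem D hD =>
    induction hD with
    | one => simpa using hu
    | mul a c x D hx _ ih =>
      rw [map_mul, add_assoc]
      exact R.rhoU_ι_mem hx ih
  | zero => simp
  | add D D' _ _ h h' => simpa using add_mem h h'
  | smul c D _ h => simpa using Submodule.smul_mem _ c h

theorem matrixCoeff_eq_zero {v w : smoothVectors E R.π} {d : Gam n} (hv : (v : ℋ) ∈ W.gr d)
    (hw : (w : ℋ) ∈ W.gr d) {a : Gam n} (ha : a ≠ 0) {s : P.SMonoid} (hs : s ∈ P.SDeg a) :
    R.matrixCoeff v w s = 0 :=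
  W.inner_orthogonal (a + d) d _ _ (by simpa using ha) (R.π_mem _ _ _ (R.rhoU_mem hs hv)) hw

/-! ### The formal adjoint of `ρ(D)` and positivity -/

/-- For `x ∈ 𝔤_a`, the operator `-conj(α(a)) ρ(x)` is the formal adjoint of `ρ(x)` for the
ordinary inner product, on homogeneous vectors. -/
theorem inner_rho_left {a b : Gam n} {x : 𝔤} (hx : x ∈ P.gr a) {v : smoothVectors E R.π}
    (hv : (v : ℋ) ∈ W.gr b) (u : smoothVectors E R.π) :
    inner ℂ (R.ρ x v : ℋ) (u : ℋ)
      = -(starRingEnd ℂ) (alpha a) * inner ℂ (v : ℋ) (R.ρ x u : ℋ) := by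
  have h1 := W.inner_eq_alpha_mul_form hv (R.ρ x u : ℋ)
  have h2 := W.inner_eq_alpha_mul_form (R.ρ_mem a b x v hx hv) (u : ℋ)
  have h3 := R.ρ_adjoint a b x v u hx hv
  have h4 : W.form ((-(R.ρ x)) v : ℋ) (u : ℋ) = -W.form (R.ρ x v : ℋ) (u : ℋ) := by simp
  -- `α(a + b) = β(a, b) α(a) α(b)` absorbs the sign `β(a, b)` of the graded adjoint.
  have key : inner ℂ (u : ℋ) (R.ρ x v : ℋ)
      = -alpha a * inner ℂ (R.ρ x u : ℋ) (v : ℋ) := by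
    rw [h1, h2, h3, h4, alpha_add]
    ring
  rw [← inner_conj_symm, key, map_mul, map_neg, inner_conj_symm]

/-- The span of the homogeneous smooth vectors. -/
def homogeneousSpan : Submodule ℂ (smoothVectors E R.π) :=
  ⨆ b, (W.gr b).comap (smoothVectors E R.π).subtype

theorem mem_homogeneousSpan {b : Gam n} {v : smoothVectors E R.π} (hv : (v : ℋ) ∈ W.gr b) :
    v ∈ R.homogeneousSpan :=
  Submodule.mem_iSup_of_mem (p := fun b => (W.gr b).comap (smoothVectors E R.π).subtype) b hv

/-- On the span of the homogeneous smooth vectors, which is stable under `ρ(D)`, the operator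
`ρ(D*)` is the formal adjoint of `ρ(D)`. -/
theorem rhoU_homogeneousSpan (D : P.U) : ∀ v ∈ R.homogeneousSpan, R.ρU D v ∈ R.homogeneousSpan ∧
    ∀ u : smoothVectors E R.π,
      inner ℂ (R.ρU D v : ℋ) (u : ℋ) = inner ℂ (v : ℋ) (R.ρU (P.starU D) u : ℋ) := by
  induction D using P.UEA_induction with
  | algebraMap c =>
    intro v hv
    rw [LieSuperalgebra.starU_algebraMap, AlgHom.commutes, AlgHom.commutes]
    refine ⟨Submodule.smul_mem _ c hv, fun u => ?_⟩
    rw [Module.algebraMap_end_apply, Module.algebraMap_end_apply, Submodule.coe_smul,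
      Submodule.coe_smul, inner_smul_left, inner_smul_right]
  | ι a x hx =>
    have hstar : R.ρU (P.starU (P.ι (1 ⊗ₜ x))) = (-(starRingEnd ℂ) (alpha a)) • R.ρ x := by
      have h : ((-(starRingEnd ℂ) (alpha a)) ⊗ₜ[ℝ] x : ℂ ⊗[ℝ] 𝔤)
          = (-(starRingEnd ℂ) (alpha a)) • ((1 : ℂ) ⊗ₜ[ℝ] x) := by
        rw [TensorProduct.smul_tmul', smul_eq_mul, mul_one]
      rw [LieSuperalgebra.starU_ι, LieSuperalgebra.starC_tmul _ 1 hx, one_mul, h, map_smul,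
        map_smul, rhoU_ι]
    intro v hv
    rw [hstar, rhoU_ι]
    induction hv using Submodule.iSup_induction' with
    | mem b v hv =>
      refine ⟨R.mem_homogeneousSpan (R.ρ_mem a b x v hx hv), fun u => ?_⟩
      rw [R.inner_rho_left hx hv u]
      simp [inner_smul_right]
    | zero => simp
    | add v v' _ _ h h' =>
      refine ⟨by rw [map_add]; exact add_mem h.1 h'.1, fun u => ?_⟩
      rw [map_add, Submodule.coe_add, Submodule.coe_add, inner_add_left, inner_add_left, h.2, h'.2]
  | mul D D' h h' =>
    intro v hv
    obtain ⟨h1, h2⟩ := h' v hv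
    obtain ⟨h3, h4⟩ := h _ h1
    rw [LieSuperalgebra.starU_mul, map_mul, map_mul]
    exact ⟨h3, fun u => (h4 u).trans (h2 _)⟩
  | add D D' h h' =>
    intro v hv
    rw [LieSuperalgebra.starU_add, map_add, map_add]
    refine ⟨add_mem (h v hv).1 (h' v hv).1, fun u => ?_⟩
    rw [LinearMap.add_apply, LinearMap.add_apply, Submodule.coe_add, Submodule.coe_add,
      inner_add_left, inner_add_right, (h v hv).2, (h' v hv).2]

theorem inner_rhoU_left {b : Gam n} {v : smoothVectors E R.π} (hv : (v : ℋ) ∈ W.gr b) (D : P.U)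
    (u : smoothVectors E R.π) :
    inner ℂ (R.ρU D v : ℋ) (u : ℋ) = inner ℂ (v : ℋ) (R.ρU (P.starU D) u : ℋ) :=
  (R.rhoU_homogeneousSpan D v (R.mem_homogeneousSpan hv)).2 u

theorem piSmooth_inv_mul (g : G) : piSmooth (E := E) R.π g⁻¹ * piSmooth R.π g = 1 := by
  ext u
  change R.π g⁻¹ (R.π g (u : ℋ)) = u
  simp

theorem piSmooth_mul_rhoU (g : G) (D : P.U) :
    piSmooth (E := E) R.π g * R.ρU D = R.ρU (P.AdU g D) * piSmooth R.π g := by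
  induction D using P.UEA_induction with
  | algebraMap c =>
    rw [AlgHom.commutes (P.AdU g), AlgHom.commutes]
    exact (Algebra.commutes c (piSmooth (E := E) R.π g)).symm
  | ι a x hx =>
    rw [HCPair.AdU_ι, rhoU_ι, rhoU_ι, ← R.ρ_Ad, mul_assoc, piSmooth_inv_mul, mul_one]
  | mul D D' h h' => rw [map_mul, map_mul, map_mul, ← mul_assoc, h, mul_assoc, h', mul_assoc]
  | add D D' h h' => rw [map_add, map_add, map_add, mul_add, add_mul, h, h']

theorem pi_rhoU (g : G) (D : P.U) (u : smoothVectors E R.π) :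
    R.π g (R.ρU D u : ℋ) = R.ρU (P.AdU g D) (piSmooth R.π g u) :=
  congrArg Subtype.val (LinearMap.congr_fun (R.piSmooth_mul_rhoU g D) u)

/-- The vector `π(g) ρ(D) v`, for `s = (g, D) ∈ 𝒮`. -/
noncomputable def orbitVector (v : smoothVectors E R.π) (s : P.SMonoid) : ℋ :=
  R.π s.g (R.ρU s.D v : ℋ)

theorem inner_star_mul {b : Gam n} {v : smoothVectors E R.π} (hv : (v : ℋ) ∈ W.gr b)
    (s t : P.SMonoid) :
    R.matrixCoeff v v (star s * t) = inner ℂ (R.orbitVector v s) (R.orbitVector v t) := by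
  have hAd : P.AdU (s.g⁻¹ * t.g) (P.AdU t.g⁻¹ (P.AdU s.g (P.starU s.D))) = P.starU s.D := by
    simp only [← AlgHom.comp_apply, ← HCPair.AdU_mul]
    simp [HCPair.AdU_one]
  change inner ℂ (v : ℋ) (R.π (s.g⁻¹ * t.g)
    (R.ρU (P.AdU t.g⁻¹ (P.AdU s.g (P.starU s.D)) * t.D) v : ℋ)) = _
  rw [map_mul R.ρU, Module.End.mul_apply, pi_rhoU, hAd, ← R.inner_rhoU_left hv]
  change inner ℂ (R.ρU s.D v : ℋ) (R.π (s.g⁻¹ * t.g) (R.ρU t.D v : ℋ)) = _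
  rw [← (R.π s.g).inner_map_map]
  change inner ℂ _ ((R.π s.g * R.π (s.g⁻¹ * t.g)) (R.ρU t.D v : ℋ)) = _
  rw [← map_mul, mul_inv_cancel_left]
  rfl

theorem isPosDef_coeffFunction {d : Gam n} {v : smoothVectors E R.π} (hv : (v : ℋ) ∈ W.gr d) :
    (R.coeffFunction v v).IsPosDef where
  support _ ha _ hs := R.matrixCoeff_eq_zero hv hv ha hs
  nonneg m c s := by
    have h : ∑ i, ∑ j, (starRingEnd ℂ) (c i) * c j * (R.coeffFunction v v).check (star (s i) * s j)
        = inner ℂ (∑ i, c i • R.orbitVector v (s i)) (∑ i, c i • R.orbitVector v (s i)) := by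
      rw [sum_inner]
      refine Finset.sum_congr rfl fun i _ => ?_
      rw [inner_smul_left, inner_sum, Finset.mul_sum]
      refine Finset.sum_congr rfl fun j _ => ?_
      rw [check_coeffFunction, R.inner_star_mul hv, inner_smul_right, mul_assoc]
    rw [h, inner_self_eq_norm_sq_to_K (𝕜 := ℂ)]
    positivity

end UnitaryRep

end GammaSuper

theorem mainTheorem3 {n : ℕ}
    {E : Type*} [NormedAddCommGroup E] [NormedSpace ℝ E] [FiniteDimensional ℝ E]
    {G : Type*} [TopologicalSpace G] [ChartedSpace E G] [Group G]
    [LieGroup (modelWithCornersSelf ℝ E) ∞ G]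
    {𝔤 : Type*} [AddCommGroup 𝔤] [Module ℝ 𝔤] (P : GammaSuper.HCPair n (E := E) G 𝔤)
    {ℋ : Type*} [NormedAddCommGroup ℋ] [InnerProductSpace ℂ ℋ] [CompleteSpace ℋ]
    (W : GammaSuper.GradedHilbert n ℋ) (R : GammaSuper.UnitaryRep P W)
    (v w : GammaSuper.smoothVectors E R.π) (d : GammaSuper.Gam n)
    (hv : (v : ℋ) ∈ W.gr d) (hw : (w : ℋ) ∈ W.gr d) :
    ∃ f : P.SuperFunction,
      (∀ s : P.SMonoid, f.check s = R.matrixCoeff v w s) ∧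
      (∀ a : GammaSuper.Gam n, a ≠ 0 → ∀ s ∈ P.SDeg a, f.check s = 0) ∧
      (v = w → f.IsPosDef) :=
  ⟨R.coeffFunction v w, R.check_coeffFunction v w,
    fun _ ha _ hs => R.matrixCoeff_eq_zero hv hw ha hs,
    fun h => by subst h; exact R.isPosDef_coeffFunction hv⟩
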